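/- Let $k$ be a field of prime characteristic $p$, let $n\ge 2$, and set $$R=\frac{k[t,x_1,\ldots,x_n]}{(f_1,\ldots,f_r)},$$ where $t,x_1,\ldots,x_n$ are variables and $f_1,\ldots,f_r$ are homogeneous polynomials with respect to the grading in which $\deg t=0$ and $\deg x_i=1$ for $i=1,\ldots,n$. Let $I=(x_1,\ldots,x_n)\subseteq R$. For an ideal $J$ of $R$ and a power $q$ of $p$, let $J^{[q]}$ denote the ideal generated by the $q$-th powers of the elements of $J$ (equivalently, of a set of generators of $J$), and for a non-negative integer $c$ write $J^{c[q]}=(J^{c})^{[q]}$. Then there is a constant $c$ such that for every $q=p^e$, $e\ge 0$, there is a primary decomposition $$I^{[q]}=Q_1\cap Q_2\cap\cdots\cap Q_m$$ (with $m$ depending on $q$) such that $(\sqrt{Q_i})^{c[q^{n-1}]}\subseteq Q_i$ for all $i=1,\ldots,m$. (If $R=0$, the empty decomposition $m=0$ of the unit ideal is allowed.) -/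

import Mathlib

open MvPolynomial

/-- The `q`-th Frobenius (bracket) power `J^[q]` of an ideal `J`: the ideal generated by the `q`-th
powers of the elements of `J`. In characteristic `p` and for `q` a power of `p` it is generated by
the `q`-th powers of any set of generators of `J`, see `Ideal.frobeniusPower_span`. -/
def Ideal.frobeniusPower {R : Type*} [CommRing R] (J : Ideal R) (q : ℕ) : Ideal R :=
  Ideal.span ((fun a => a ^ q) '' (J : Set R))

theorem Ideal.frobeniusPower_span {R : Type*} [CommRing R] {p : ℕ} (hp : p.Prime)
    (hR : (p : R) = 0) (e : ℕ) (S : Set R) :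
    (Ideal.span S).frobeniusPower (p ^ e) = Ideal.span ((fun a => a ^ p ^ e) '' S) := by
  apply le_antisymm
  · refine Ideal.span_le.mpr ?_
    rintro _ ⟨a, ha, rfl⟩
    change a ^ p ^ e ∈ Ideal.span ((fun a => a ^ p ^ e) '' S)
    refine Submodule.span_induction (p := fun x _ => x ^ p ^ e ∈ _) ?_ ?_ ?_ ?_ ha
    · exact fun x hx => Ideal.subset_span ⟨x, hx, rfl⟩
    · rw [zero_pow (pow_ne_zero e hp.ne_zero)]
      exact Ideal.zero_mem _
    · intro x y _ _ hx hy
      obtain ⟨r, hr⟩ := exists_add_pow_prime_pow_eq hp x y e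
      rw [hr, hR]
      simpa using Ideal.add_mem _ hx hy
    · intro a x _ hx
      rw [smul_eq_mul, mul_pow]
      exact Ideal.mul_mem_left _ _ hx
  · exact Ideal.span_mono (Set.image_mono Ideal.subset_span)

/-- The grading on `k[t, x_1, …, x_n]` with `deg t = 0` and `deg x_i = 1`. The variable `t` is
`X none` and the variable `x_i` is `X (some i)`. -/
def txWeight (n : ℕ) : Option (Fin n) → ℕ
  | none => 0
  | some _ => 1

/-- The ring `R = k[t, x_1, …, x_n] / (f_1, …, f_r)`. -/
abbrev TXQuotient {k : Type*} [Field k] {n r : ℕ}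
    (f : Fin r → MvPolynomial (Option (Fin n)) k) : Type _ :=
  MvPolynomial (Option (Fin n)) k ⧸ Ideal.span (Set.range f)

/-- The ideal `(x_1, …, x_n)` of `R = k[t, x_1, …, x_n] / (f_1, …, f_r)`. -/
noncomputable def xIdeal {k : Type*} [Field k] {n r : ℕ}
    (f : Fin r → MvPolynomial (Option (Fin n)) k) : Ideal (TXQuotient f) :=
  Ideal.span (Set.range fun i : Fin n =>
    Ideal.Quotient.mk (Ideal.span (Set.range f)) (X (some i)))

/-!
Grade `R` by the degree in the `x_i`, so that each graded piece of `R / I^[q]` is a `k[t]`-module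
presented by a matrix whose rows are indexed by the monomials of that degree with all exponents
less than `q` and whose entries are coefficients of the `f_j`. There are at most `q ^ (n - 1)` rows,
because the degree determines the last exponent, and the entries have bounded degree in `t`, say at
most `D`. By Cramer's rule a nonzero minor, of degree at most `D * q ^ (n - 1)`, kills the torsion,
hence `g ^ (D * q ^ (n - 1))` kills the `g`-primary torsion for every irreducible `g` in `k[t]`.

If `h` generates the annihilator of the whole torsion, then `I^[q]` is the intersection of
`I^[q] : h` and the primary components of `I^[q] + (h)`. The first is `I`-primary or the unit ideal:
nonzero elements of `k[t]` are nonzerodivisors modulo `I^[q] : h`, and modulo `I` every element of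
`R` comes from `k[t]`. The radicals of the others lie in `I + (g)` for irreducible factors `g` of
`h`, which divide `h` at most `D * q ^ (n - 1)` times.
-/

section BoundedTorsion

variable {A M M' : Type*} [CommRing A] [AddCommGroup M] [Module A M] [AddCommGroup M']
  [Module A M']

/-- For every irreducible `g`, the `g`-primary torsion of `M ⧸ W` is killed by `g ^ N`. -/
def BoundedTorsion (W : Submodule A M) (N : ℕ) : Prop :=
  ∀ ⦃g : A⦄, Irreducible g → ∀ (e : ℕ) (x : M), g ^ e • x ∈ W → g ^ N • x ∈ W

namespace BoundedTorsion

variable {N : ℕ}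

theorem comap {W : Submodule A M'} (hW : BoundedTorsion W N) (φ : M →ₗ[A] M') :
    BoundedTorsion (W.comap φ) N := fun g hg e x hx => by
  simpa only [Submodule.mem_comap, map_smul] using
    hW hg e (φ x) (by simpa only [Submodule.mem_comap, map_smul] using hx)

theorem of_comap {W : Submodule A M'} {φ : M →ₗ[A] M'} (hφ : Function.Surjective φ)
    (hW : BoundedTorsion (W.comap φ) N) : BoundedTorsion W N := fun g hg e y hy => by
  obtain ⟨x, rfl⟩ := hφ y
  simpa only [Submodule.mem_comap, map_smul] using
    hW hg e x (by simpa only [Submodule.mem_comap, map_smul] using hy)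

theorem iInf {ι : Sort*} {W : ι → Submodule A M} (hW : ∀ i, BoundedTorsion (W i) N) :
    BoundedTorsion (⨅ i, W i) N := fun _ hg e x hx =>
  Submodule.mem_iInf _ |>.mpr fun i => hW i hg e x (Submodule.mem_iInf _ |>.mp hx i)

theorem mono {N' : ℕ} {W : Submodule A M} (hW : BoundedTorsion W N) (hN : N ≤ N') :
    BoundedTorsion W N' := fun g hg e x hx => by
  rw [← Nat.sub_add_cancel hN, pow_add, mul_smul]
  exact W.smul_mem _ (hW hg e x hx)

end BoundedTorsion

end BoundedTorsion

section Minors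

variable {A κ ι : Type*} [CommRing A] [Fintype κ] [DecidableEq κ]

theorem exists_minor_ne_zero [IsDomain A] {w : κ → ι → A} (hw : LinearIndependent A w) :
    ∃ f : κ → ι, (Matrix.of fun i j => w i (f j)).det ≠ 0 := by
  let col (i : ι) (l : κ) : A := w l i
  obtain ⟨s, hs, hmax⟩ := exists_maximal_linearIndepOn A col
  have hs' : LinearIndependent A fun i : s => col i := hs
  have := hs'.finite
  have := Fintype.ofFinite s
  -- A relation between the rows that holds at the columns in `s` holds at every column, since
  -- by maximality each column has a nonzero multiple in the span of those in `s`.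
  have hrow : LinearIndependent A fun l (i : s) => w l i := by
    rw [Fintype.linearIndependent_iff] at hw ⊢
    refine fun c hc => hw c (funext fun i => ?_)
    let φ := Fintype.linearCombination A c
    have hφ (i : ι) : φ (col i) = (∑ l, c l • w l) i := by
      simp [φ, col, Fintype.linearCombination_apply, mul_comm]
    have hker : Submodule.span A (col '' s) ≤ LinearMap.ker φ := by
      rw [Submodule.span_le, Set.image_subset_iff]
      intro i hi
      have := congrFun hc ⟨i, hi⟩
      simpa [hφ] using this
    rw [← hφ, Pi.zero_apply]
    by_cases hi : i ∈ s
    · exact hker (Submodule.subset_span ⟨i, hi, rfl⟩)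
    · obtain ⟨a, ha, hai⟩ := hmax i hi
      simpa [ha] using hker hai
  have hcard : Fintype.card κ = Fintype.card s :=
    le_antisymm (by simpa using hrow.fintype_card_le_finrank)
      (by simpa using hs'.fintype_card_le_finrank)
  let e := Fintype.equivOfCardEq hcard
  refine ⟨fun j => e j, Matrix.nonsingular_iff_det_ne_zero.mp ?_⟩
  exact .of_linearIndependent_col (hs'.comp e e.injective)

theorem minor_smul_mem_span [IsDomain A] (w : κ → ι → A) (f : κ → ι) {b : A} (hb : b ≠ 0)
    {z : ι → A} (hz : b • z ∈ Submodule.span A (Set.range w)) :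
    (Matrix.of fun i j => w i (f j)).det • z ∈ Submodule.span A (Set.range w) := by
  set N : Matrix κ κ A := .of fun i j => w i (f j) with hN
  obtain ⟨c, hc⟩ := (Submodule.mem_span_range_iff_exists_fun A).mp hz
  have hcN : b • (z ∘ f) = Matrix.vecMul c N := by
    ext j
    simpa [Matrix.vecMul, dotProduct, hN] using (congrFun hc (f j)).symm
  have hcramer : b • Matrix.vecMul (z ∘ f) N.adjugate = N.det • c := by
    rw [← Matrix.smul_vecMul, hcN, Matrix.vecMul_vecMul, Matrix.mul_adjugate,
      Matrix.vecMul_smul, Matrix.vecMul_one]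
  refine (Submodule.mem_span_range_iff_exists_fun A).mpr
    ⟨Matrix.vecMul (z ∘ f) N.adjugate, smul_right_injective _ hb ?_⟩
  calc b • ∑ i, Matrix.vecMul (z ∘ f) N.adjugate i • w i
      = ∑ i, (b • Matrix.vecMul (z ∘ f) N.adjugate) i • w i := by
        simp only [Finset.smul_sum, Pi.smul_apply, smul_assoc]
    _ = N.det • ∑ i, c i • w i := by
        rw [hcramer]
        simp only [Finset.smul_sum, Pi.smul_apply, smul_assoc]
    _ = b • N.det • z := by rw [hc, smul_comm]

theorem natDegree_det_le (M : Matrix κ κ (Polynomial A)) (D : ℕ)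
    (hM : ∀ i j, (M i j).natDegree ≤ D) : M.det.natDegree ≤ D * Fintype.card κ := by
  rw [Matrix.det_apply]
  refine Polynomial.natDegree_sum_le_of_forall_le _ _ fun σ _ => ?_
  calc (Equiv.Perm.sign σ • ∏ i, M (σ i) i).natDegree
      ≤ (∏ i, M (σ i) i).natDegree := Polynomial.natDegree_smul_le _ _
    _ ≤ ∑ i, (M (σ i) i).natDegree := Polynomial.natDegree_prod_le _ _
    _ ≤ ∑ _i : κ, D := Finset.sum_le_sum fun i _ => hM _ _
    _ = D * Fintype.card κ := by
      rw [Finset.sum_const, smul_eq_mul, mul_comm, Finset.card_univ]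

end Minors

theorem exists_linearIndepOn_subset_torsion {A M : Type*} [CommRing A] [IsDomain A]
    [AddCommGroup M] [Module A M] (S : Set M) :
    ∃ T ⊆ S, LinearIndepOn A id T ∧
      ∀ x ∈ Submodule.span A S, ∃ a : A, a ≠ 0 ∧ a • x ∈ Submodule.span A T := by
  obtain ⟨s, hs, hmax⟩ := exists_maximal_linearIndepOn A (Subtype.val : S → M)
  refine ⟨Subtype.val '' s, by simp, hs.id_image, fun x hx => ?_⟩
  induction hx using Submodule.span_induction with
  | mem x hx =>
    by_cases hxs : ⟨x, hx⟩ ∈ s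
    · exact ⟨1, one_ne_zero, by rw [one_smul]; exact Submodule.subset_span ⟨_, hxs, rfl⟩⟩
    · exact hmax _ hxs
  | zero => exact ⟨1, one_ne_zero, by simp⟩
  | add x y _ _ hx hy =>
    obtain ⟨a, ha, hax⟩ := hx
    obtain ⟨b, hb, hby⟩ := hy
    refine ⟨a * b, mul_ne_zero ha hb, ?_⟩
    rw [smul_add, mul_comm a b, mul_smul, mul_comm b a, mul_smul]
    exact add_mem (Submodule.smul_mem _ _ hax) (Submodule.smul_mem _ _ hby)
  | smul b x _ hx =>
    obtain ⟨a, ha, hax⟩ := hx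
    exact ⟨a, ha, by rw [smul_comm]; exact Submodule.smul_mem _ _ hax⟩

section PolynomialTorsion

open scoped Polynomial

variable {k : Type*} [Field k]

theorem exists_smul_mem_span_of_natDegree_le {ι : Type*} [Fintype ι] {S : Set (ι → k[X])} {D : ℕ}
    (hS : ∀ v ∈ S, ∀ i, (v i).natDegree ≤ D) :
    ∃ Δ : k[X], Δ ≠ 0 ∧ Δ.natDegree ≤ D * Fintype.card ι ∧ ∀ (b : k[X]) (z : ι → k[X]),
      b ≠ 0 → b • z ∈ Submodule.span k[X] S → Δ • z ∈ Submodule.span k[X] S := by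
  classical
  obtain ⟨T, hTS, hT, htors⟩ := exists_linearIndepOn_subset_torsion (A := k[X]) S
  have hT' : LinearIndependent k[X] ((↑) : T → ι → k[X]) := hT
  have := hT'.finite
  have := Fintype.ofFinite T
  obtain ⟨f, hf⟩ := exists_minor_ne_zero hT'
  refine ⟨_, hf, ?_, fun b z hb hz => ?_⟩
  · exact (natDegree_det_le _ D fun i _ => hS _ (hTS i.2) _).trans
      (Nat.mul_le_mul_left D (by simpa using hT'.fintype_card_le_finrank))
  · obtain ⟨a, ha, haz⟩ := htors _ hz
    rw [smul_smul, ← Subtype.range_coe (s := T)] at haz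
    have hΔ := minor_smul_mem_span _ f (mul_ne_zero ha hb) haz
    rw [Subtype.range_coe] at hΔ
    exact Submodule.span_mono hTS hΔ

theorem pow_smul_mem_of_natDegree_le {M : Type*} [AddCommGroup M] [Module k[X] M]
    {W : Submodule k[X] M} {x : M} {g Δ : k[X]} {e N : ℕ} (hg : Irreducible g)
    (hx : g ^ e • x ∈ W) (hΔ : Δ ≠ 0) (hΔN : Δ.natDegree ≤ N) (hΔx : Δ • x ∈ W) :
    g ^ N • x ∈ W := by
  have hann (a : k[X]) : a • x ∈ W ↔ Submodule.IsPrincipal.generator (W.colon {x}) ∣ a := by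
    rw [← Submodule.IsPrincipal.mem_iff_generator_dvd, Submodule.mem_colon_singleton]
  rw [hann] at hx hΔx ⊢
  obtain ⟨i, -, hi⟩ := (dvd_prime_pow hg.prime e).mp hx
  rw [hi.dvd_iff_dvd_left] at hΔx ⊢
  refine pow_dvd_pow g ?_
  calc i ≤ i * g.natDegree := Nat.le_mul_of_pos_right i hg.natDegree_pos
    _ = (g ^ i).natDegree := (Polynomial.natDegree_pow g i).symm
    _ ≤ Δ.natDegree := Polynomial.natDegree_le_of_dvd hΔx hΔ
    _ ≤ N := hΔN

theorem boundedTorsion_span_of_natDegree_le {ι : Type*} [Fintype ι] {S : Set (ι → k[X])} {D : ℕ}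
    (hS : ∀ v ∈ S, ∀ i, (v i).natDegree ≤ D) :
    BoundedTorsion (Submodule.span k[X] S) (D * Fintype.card ι) := by
  obtain ⟨Δ, hΔ, hdeg, htors⟩ := exists_smul_mem_span_of_natDegree_le hS
  exact fun g hg e x hx => pow_smul_mem_of_natDegree_le hg hx hΔ hdeg
    (htors _ _ (pow_ne_zero e hg.ne_zero) hx)

end PolynomialTorsion

section ReducedMonomials

variable {σ A : Type*} [Fintype σ] [DecidableEq σ] [CommRing A]

variable (σ) in
/-- The exponents of the monomials of degree `d` in which every variable has exponent less than `q`,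
i.e. of a basis of the degree `d` part of the quotient by the `q`-th powers of the variables. -/
def reducedExponents (q d : ℕ) : Finset (σ →₀ ℕ) :=
  (Finset.univ.finsuppAntidiag d).filter fun a => ∀ i, a i < q

theorem mem_reducedExponents {q d : ℕ} {a : σ →₀ ℕ} :
    a ∈ reducedExponents σ q d ↔ a.degree = d ∧ ∀ i, a i < q := by
  simp [reducedExponents, Finset.mem_finsuppAntidiag, Finsupp.degree_eq_sum]

theorem card_reducedExponents_le [Nonempty σ] (q d : ℕ) :
    (reducedExponents σ q d).card ≤ q ^ (Fintype.card σ - 1) := by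
  obtain ⟨i₀⟩ := ‹Nonempty σ›
  let restrict (a : reducedExponents σ q d) (i : {i : σ // i ≠ i₀}) : Fin q :=
    ⟨a.1 i, (mem_reducedExponents.mp a.2).2 i⟩
  have hinj : Function.Injective restrict := by
    intro a b hab
    have hne (i : {i : σ // i ≠ i₀}) : a.1 i = b.1 i := congrArg Fin.val (congrFun hab i)
    have hdeg : a.1.degree = b.1.degree := by
      rw [(mem_reducedExponents.mp a.2).1, (mem_reducedExponents.mp b.2).1]
    rw [Finsupp.degree_eq_sum, Finsupp.degree_eq_sum, Fintype.sum_eq_add_sum_subtype_ne _ i₀,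
      Fintype.sum_eq_add_sum_subtype_ne (⇑b.1) i₀, Finset.sum_congr rfl fun i _ => hne i,
      add_left_inj] at hdeg
    ext i
    by_cases hi : i = i₀
    · rw [hi, hdeg]
    · exact hne ⟨i, hi⟩
  simpa [Fintype.card_subtype_compl] using Fintype.card_le_of_injective restrict hinj

/-- The coefficients of the monomials with exponents in `reducedExponents σ q d`, which are the
coordinates of the degree `d` part of a polynomial modulo the `q`-th powers of the variables. -/
noncomputable def reducedCoeff (q d : ℕ) : MvPolynomial σ A →ₗ[A] reducedExponents σ q d → A :=
  LinearMap.pi fun a => lcoeff A a.1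

omit [Fintype σ] [DecidableEq σ] in
theorem mem_of_forall_mem_support_exists_le {q : ℕ} {J : Ideal (MvPolynomial σ A)}
    (hJ : ∀ i, X i ^ q ∈ J) {z : MvPolynomial σ A} (hz : ∀ a ∈ z.support, ∃ i, q ≤ a i) :
    z ∈ J := by
  have hle : Ideal.span ((fun a : σ →₀ ℕ => monomial a (1 : A)) ''
      Set.range fun i => Finsupp.single i q) ≤ J := by
    rw [Ideal.span_le]
    rintro _ ⟨_, ⟨i, rfl⟩, rfl⟩
    simpa only [SetLike.mem_coe, X_pow_eq_monomial] using hJ i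
  refine hle (mem_ideal_span_monomial_image.mpr fun a ha => ?_)
  obtain ⟨i, hi⟩ := hz a ha
  exact ⟨_, ⟨i, rfl⟩, Finsupp.single_le_iff.mpr hi⟩

attribute [local instance] MvPolynomial.gradedAlgebra

theorem homogeneousComponent_mem_of_reducedCoeff_eq_zero {q d : ℕ} {J : Ideal (MvPolynomial σ A)}
    (hJ : ∀ i, X i ^ q ∈ J) {z : MvPolynomial σ A} (hz : reducedCoeff q d z = 0) :
    homogeneousComponent d z ∈ J := by
  refine mem_of_forall_mem_support_exists_le hJ fun a ha => ?_
  rw [mem_support_iff, coeff_homogeneousComponent, ite_ne_right_iff] at ha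
  by_contra! hlt
  exact ha.2 (congrFun hz ⟨a, mem_reducedExponents.mpr ⟨ha.1, hlt⟩⟩)

theorem restrictScalars_eq_iInf_comap_map_reducedCoeff {q : ℕ} {J : Ideal (MvPolynomial σ A)}
    (hJ : J.IsHomogeneous (homogeneousSubmodule σ A)) (hX : ∀ i, X i ^ q ∈ J) :
    J.restrictScalars A =
      ⨅ d, ((J.restrictScalars A).map (reducedCoeff q d)).comap (reducedCoeff q d) := by
  refine le_antisymm (le_iInf fun d => Submodule.le_comap_map _ _) fun z hz => ?_
  rw [Submodule.restrictScalars_mem, mem_iff_homogeneousComponent_mem hJ]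
  intro d
  obtain ⟨w, hw, hwz⟩ := (Submodule.mem_iInf _).mp hz d
  have hzw : homogeneousComponent d (z - w) ∈ J :=
    homogeneousComponent_mem_of_reducedCoeff_eq_zero hX (by rw [map_sub, hwz, sub_self])
  rw [map_sub] at hzw
  exact (Submodule.sub_mem_iff_left J (homogeneousComponent_mem_of_mem hJ hw d)).mp hzw

end ReducedMonomials

section HomogeneousIdeals

open scoped Pointwise Polynomial
attribute [local instance] MvPolynomial.gradedAlgebra

variable {σ A : Type*} [CommRing A]

theorem restrictScalars_span_eq_span_monomial_smul (S : Set (MvPolynomial σ A)) :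
    (Ideal.span S).restrictScalars A =
      Submodule.span A ((Set.range fun a : σ →₀ ℕ => monomial a (1 : A)) • S) := by
  refine (Submodule.span_smul_of_span_eq_top ?_ S).symm
  simpa only [coe_basisMonomials] using (basisMonomials σ A).span_eq

variable {k : Type*} [Field k]

theorem boundedTorsion_restrictScalars_span [Fintype σ] [Nonempty σ]
    {S : Set (MvPolynomial σ k[X])} {q D : ℕ}
    (hS : ∀ z ∈ S, ∃ d, z.IsHomogeneous d) (hD : ∀ z ∈ S, ∀ a, (coeff a z).natDegree ≤ D)
    (hX : ∀ i, X i ^ q ∈ Ideal.span S) :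
    BoundedTorsion ((Ideal.span S).restrictScalars k[X]) (D * q ^ (Fintype.card σ - 1)) := by
  classical
  have hhom : (Ideal.span S).IsHomogeneous (homogeneousSubmodule σ k[X]) :=
    Ideal.homogeneous_span _ S hS
  rw [restrictScalars_eq_iInf_comap_map_reducedCoeff hhom hX]
  refine .iInf fun d => .comap ?_ _
  rw [restrictScalars_span_eq_span_monomial_smul, Submodule.map_span]
  refine (boundedTorsion_span_of_natDegree_le ?_).mono
    (Nat.mul_le_mul_left D ((Fintype.card_coe _).trans_le (card_reducedExponents_le q d)))
  rintro _ ⟨_, ⟨_, ⟨b, rfl⟩, z, hz, rfl⟩, rfl⟩ a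
  change (coeff a.1 (monomial b 1 * z)).natDegree ≤ D
  rw [coeff_monomial_mul']
  split_ifs
  · rw [one_mul]; exact hD z hz _
  · rw [Polynomial.natDegree_zero]; exact D.zero_le

end HomogeneousIdeals

section FrobeniusPower

variable {B : Type*} [CommRing B]

theorem frobeniusPower_mono {I J : Ideal B} (h : I ≤ J) (q : ℕ) :
    I.frobeniusPower q ≤ J.frobeniusPower q :=
  Ideal.span_mono (Set.image_mono h)

theorem frobeniusPower_sup_span_singleton {p : ℕ} (hp : p.Prime) (hB : (p : B) = 0) (e : ℕ)
    (I : Ideal B) (b : B) :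
    (I ⊔ Ideal.span {b}).frobeniusPower (p ^ e) =
      I.frobeniusPower (p ^ e) ⊔ Ideal.span {b ^ p ^ e} := by
  conv_lhs => rw [← I.span_eq, ← Ideal.span_union, Ideal.frobeniusPower_span hp hB,
    Set.image_union, Set.image_singleton, Ideal.span_union]
  rfl

theorem pow_mem_frobeniusPower {I : Ideal B} {b : B} (hb : b ∈ I) (q : ℕ) :
    b ^ q ∈ I.frobeniusPower q :=
  Ideal.subset_span ⟨b, hb, rfl⟩

theorem le_radical_of_frobeniusPower_le {I J : Ideal B} {q : ℕ} (h : I.frobeniusPower q ≤ J) :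
    I ≤ J.radical := fun _ hb => ⟨q, h (pow_mem_frobeniusPower hb q)⟩

theorem frobeniusPower_anti {q q' : ℕ} (h : q ≤ q') (I : Ideal B) :
    I.frobeniusPower q' ≤ I.frobeniusPower q := by
  rw [Ideal.frobeniusPower, Ideal.span_le]
  rintro _ ⟨b, hb, rfl⟩
  exact Ideal.pow_mem_of_pow_mem _ (pow_mem_frobeniusPower hb q) h

end FrobeniusPower

section TorsionExponent

variable {A B : Type*} [CommRing A] [IsDomain A] [CommRing B] [Algebra A B]

theorem exists_ne_zero_forall_smul_mem [IsNoetherianRing B] (J : Ideal B) :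
    ∃ h : A, h ≠ 0 ∧ ∀ (s : A) (b : B), s ≠ 0 → s • b ∈ J → h • b ∈ J := by
  have hmem (a : A) (b : B) : b ∈ J.colon {algebraMap A B a} ↔ a • b ∈ J := by
    rw [Submodule.mem_colon_singleton, smul_eq_mul, mul_comm, Algebra.smul_def]
  obtain ⟨_, ⟨h, hh, rfl⟩, hmax⟩ := set_has_maximal_iff_noetherian.mpr ‹IsNoetherianRing B›
    ((fun a : A => J.colon {algebraMap A B a}) '' {a | a ≠ 0}) ⟨_, 1, one_ne_zero, rfl⟩
  refine ⟨h, hh, fun s b hs hb => ?_⟩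
  have hle : J.colon {algebraMap A B h} ≤ J.colon {algebraMap A B (s * h)} := fun x hx => by
    rw [hmem] at hx ⊢
    rw [mul_smul]
    exact Submodule.smul_of_tower_mem J s hx
  have heq := hle.eq_of_not_lt (hmax _ ⟨s * h, mul_ne_zero hs hh, rfl⟩)
  rw [← hmem, heq, hmem, mul_comm, mul_smul]
  exact Submodule.smul_of_tower_mem J h hb

theorem BoundedTorsion.exists_forall_smul_mem [IsPrincipalIdealRing A] [IsNoetherianRing B]
    {J : Ideal B} {N : ℕ} (hJ : BoundedTorsion (J.restrictScalars A) N) :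
    ∃ h : A, h ≠ 0 ∧ (∀ (s : A) (b : B), s ≠ 0 → s • b ∈ J → h • b ∈ J) ∧
      ∀ g : A, Irreducible g → ¬ g ^ (N + 1) ∣ h := by
  let 𝔞 : Ideal A := (J.restrictScalars A).colon {b | ∃ s : A, s ≠ 0 ∧ s • b ∈ J}
  have hmem (a : A) : a ∈ 𝔞 ↔ ∀ (s : A) (b : B), s ≠ 0 → s • b ∈ J → a • b ∈ J := by
    rw [Submodule.mem_colon]
    exact ⟨fun H s b hs hb => H b ⟨s, hs, hb⟩, fun H b ⟨s, hs, hb⟩ => H s b hs hb⟩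
  obtain ⟨h, h𝔞 : 𝔞 = Ideal.span {h}⟩ := IsPrincipalIdealRing.principal 𝔞
  have hdvd (a : A) : a ∈ 𝔞 ↔ h ∣ a := by rw [h𝔞, Ideal.mem_span_singleton]
  have hh : h ≠ 0 := by
    rintro rfl
    obtain ⟨h', hh', htors⟩ := exists_ne_zero_forall_smul_mem (A := A) J
    exact hh' (zero_dvd_iff.mp ((hdvd h').mp ((hmem h').mpr htors)))
  refine ⟨h, hh, (hmem h).mp ((hdvd h).mpr dvd_rfl), ?_⟩
  rintro g hg ⟨u, rfl⟩
  have hu : g ^ N * u ∈ 𝔞 := (hmem _).mpr fun s b hs hb => by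
    have := (hmem _).mp ((hdvd _).mpr dvd_rfl) s b hs hb
    rw [mul_smul] at this ⊢
    exact hJ hg _ _ this
  rw [hdvd, mul_dvd_mul_iff_right (right_ne_zero_of_mul hh),
    pow_dvd_pow_iff hg.ne_zero hg.not_isUnit] at hu
  exact N.not_succ_le_self hu

end TorsionExponent

section PrimaryComponents

variable {A B : Type*} [CommRing A] [IsDomain A] [CommRing B] [Algebra A B] {I J Q : Ideal B}

theorem colon_singleton_inf_sup_span_singleton {h : B} (hh : ∀ b, h * (h * b) ∈ J → h * b ∈ J) :
    J.colon {h} ⊓ (J ⊔ Ideal.span {h}) = J := by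
  refine le_antisymm ?_ (le_inf (fun b hb => ?_) le_sup_left)
  · rintro z ⟨hz, hz'⟩
    rw [SetLike.mem_coe, Submodule.mem_colon_singleton, smul_eq_mul, mul_comm] at hz
    obtain ⟨j, hj, y, hy, rfl⟩ := Submodule.mem_sup.mp hz'
    obtain ⟨w, rfl⟩ := Ideal.mem_span_singleton.mp hy
    rw [mul_add, add_comm, Submodule.add_mem_iff_left J (J.mul_mem_left h hj)] at hz
    exact J.add_mem hj (hh w hz)
  · exact Submodule.mem_colon_singleton.mpr (J.mul_mem_right h hb)

theorem mem_of_mul_mem_of_notMem (hQ : ∀ (s : A) (b : B), s ≠ 0 → s • b ∈ Q → b ∈ Q)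
    (hIQ : I ≤ Q.radical) (hI : ∀ b : B, ∃ a : A, algebraMap A B a - b ∈ I) {x y : B}
    (hy : y ∉ I) (hxy : y * x ∈ Q) : x ∈ Q := by
  obtain ⟨a, ha⟩ := hI y
  have ha0 : a ≠ 0 := by
    rintro rfl
    rw [map_zero, zero_sub, neg_mem_iff] at ha
    exact hy ha
  obtain ⟨l, hl⟩ := hIQ ha
  refine hQ (a ^ l) x (pow_ne_zero l ha0) ?_
  obtain ⟨u, hu⟩ := sub_dvd_pow_sub_pow (algebraMap A B a) (algebraMap A B a - y) l
  have hpow : a ^ l • x = u * (y * x) + (algebraMap A B a - y) ^ l * x := by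
    rw [Algebra.smul_def, map_pow]
    linear_combination x * hu
  rw [hpow]
  exact Q.add_mem (Q.mul_mem_left u hxy) (Q.mul_mem_right x hl)

theorem isPrimary_of_forall_smul_mem (hQ : ∀ (s : A) (b : B), s ≠ 0 → s • b ∈ Q → b ∈ Q)
    (hIQ : I ≤ Q.radical) (hI : ∀ b : B, ∃ a : A, algebraMap A B a - b ∈ I) (htop : Q ≠ ⊤) :
    Q.IsPrimary := by
  refine Ideal.isPrimary_iff.mpr ⟨htop, fun {x y} hxy => ?_⟩
  by_cases hy : y ∈ I
  · exact .inr (hIQ hy)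
  · exact .inl (mem_of_mul_mem_of_notMem hQ hIQ hI hy (mul_comm x y ▸ hxy))

theorem radical_le_of_forall_smul_mem (hQ : ∀ (s : A) (b : B), s ≠ 0 → s • b ∈ Q → b ∈ Q)
    (hIQ : I ≤ Q.radical) (hI : ∀ b : B, ∃ a : A, algebraMap A B a - b ∈ I) (htop : Q ≠ ⊤) :
    Q.radical ≤ I := by
  rintro b ⟨l, hl⟩
  by_contra hb
  induction l with
  | zero => exact htop (Q.eq_top_of_isUnit_mem hl (by rw [pow_zero]; exact isUnit_one))
  | succ l ih =>
    rw [pow_succ'] at hl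
    exact ih (mem_of_mul_mem_of_notMem hQ hIQ hI hb hl)

theorem exists_radical_le_sup_span_singleton [IsPrincipalIdealRing A] (hQ : Q.IsPrimary)
    (hIQ : I ≤ Q.radical) (hI : ∀ b : B, ∃ a : A, algebraMap A B a - b ∈ I) {h : A} {N : ℕ}
    (hh : h ≠ 0) (hhN : ∀ g : A, Irreducible g → ¬ g ^ (N + 1) ∣ h) (hhQ : algebraMap A B h ∈ Q) :
    ∃ g : A, Q.radical ≤ I ⊔ Ideal.span {algebraMap A B g} ∧ algebraMap A B g ^ N ∈ Q := by
  have := Ideal.isPrime_radical hQ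
  obtain ⟨g, hg : _ = Ideal.span {g}⟩ :=
    IsPrincipalIdealRing.principal (Q.radical.comap (algebraMap A B))
  have hdvd (a : A) : algebraMap A B a ∈ Q.radical ↔ g ∣ a := by
    rw [← Ideal.mem_comap, hg, Ideal.mem_span_singleton]
  have hgh : g ∣ h := (hdvd h).mp (Ideal.le_radical hhQ)
  have hgp : Prime g := by
    rw [← Ideal.span_singleton_prime (ne_zero_of_dvd_ne_zero hh hgh)]
    exact hg ▸ Ideal.comap_isPrime (algebraMap A B) _
  refine ⟨g, fun b hb => ?_, ?_⟩
  · obtain ⟨a, ha⟩ := hI b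
    have hga := (hdvd a).mp ((Submodule.sub_mem_iff_left _ hb).mp (hIQ ha))
    rw [← sub_sub_self (algebraMap A B a) b, sub_eq_neg_add]
    exact Submodule.add_mem_sup (I.neg_mem ha)
      (Ideal.mem_span_singleton.mpr (map_dvd (algebraMap A B) hga))
  · obtain ⟨l, u, hu, rfl⟩ := WfDvdMonoid.max_power_factor hh hgp.irreducible
    have hl : l ≤ N := by
      by_contra! hlt
      exact hhN g hgp.irreducible ((pow_dvd_pow g hlt).mul_right u)
    rw [map_mul, map_pow] at hhQ
    refine Q.pow_mem_of_pow_mem (((Ideal.isPrimary_iff.mp hQ).2 hhQ).resolve_right ?_) hl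
    rwa [hdvd]

end PrimaryComponents

section PrimaryDecomposition

variable {A B : Type*} [CommRing A] [IsDomain A] [IsPrincipalIdealRing A] [CommRing B] [Algebra A B]
  {p e c : ℕ} {I J Q : Ideal B}

theorem frobeniusPower_pow_le_of_le_sup_span_singleton (hp : p.Prime) (hB : (p : B) = 0)
    (hIQ : I.frobeniusPower (p ^ e) ≤ Q) {P : Ideal B} {b : B} (hP : P ≤ I ⊔ Ideal.span {b})
    (hb : b ^ (c * p ^ e) ∈ Q) : (P ^ (c + 1)).frobeniusPower (p ^ e) ≤ Q := by
  have hle : P ^ (c + 1) ≤ I ⊔ Ideal.span {b ^ c} :=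
    calc P ^ (c + 1) ≤ (I ⊔ Ideal.span {b}) ^ (1 + c) := by
          rw [add_comm]; exact Ideal.pow_right_mono hP _
      _ ≤ I ^ 1 ⊔ Ideal.span {b} ^ c := Ideal.sup_pow_add_le_pow_sup_pow
      _ = I ⊔ Ideal.span {b ^ c} := by rw [pow_one, Ideal.span_singleton_pow]
  refine (frobeniusPower_mono hle _).trans ?_
  rw [frobeniusPower_sup_span_singleton hp hB, ← pow_mul]
  exact sup_le hIQ ((Ideal.span_singleton_le_iff_mem Q).mpr hb)

theorem BoundedTorsion.exists_primary_decomposition [IsNoetherianRing B] (hp : p.Prime)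
    (hB : (p : B) = 0) (hI : ∀ b : B, ∃ a : A, algebraMap A B a - b ∈ I)
    (hIJ : I.frobeniusPower (p ^ e) ≤ J) (hJ : BoundedTorsion (J.restrictScalars A) (c * p ^ e)) :
    ∃ T : Finset (Ideal B), T.inf id = J ∧ ∀ Q ∈ T, Q.IsPrimary ∧
      (Q.radical ^ (c + 1)).frobeniusPower (p ^ e) ≤ Q := by
  classical
  obtain ⟨h, hh, htors, hhN⟩ := hJ.exists_forall_smul_mem
  let Q₀ := J.colon {algebraMap A B h}
  have hmem (b : B) : b ∈ Q₀ ↔ h • b ∈ J := by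
    rw [Submodule.mem_colon_singleton, smul_eq_mul, mul_comm, Algebra.smul_def]
  have hQ₀ (s : A) (b : B) (hs : s ≠ 0) (hb : s • b ∈ Q₀) : b ∈ Q₀ := by
    rw [hmem, smul_smul] at hb
    exact (hmem b).mpr (htors _ b (mul_ne_zero hh hs) hb)
  have hinf : Q₀ ⊓ (J ⊔ Ideal.span {algebraMap A B h}) = J :=
    colon_singleton_inf_sup_span_singleton fun b hb => by
      simp only [← Algebra.smul_def] at hb ⊢
      exact htors (h * h) b (mul_ne_zero hh hh) (by rwa [mul_smul])
  have hIQ₀ : I.frobeniusPower (p ^ e) ≤ Q₀ := hIJ.trans (hinf.ge.trans inf_le_left)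
  obtain ⟨s, hs, hsprim⟩ := Submodule.isLasker B B (J ⊔ Ideal.span {algebraMap A B h})
  refine ⟨(insert Q₀ s).erase ⊤, ?_, fun Q hQ => ?_⟩
  · rw [Finset.inf_erase_top, Finset.inf_insert, hs, id_eq, hinf]
  obtain ⟨htop, hQ⟩ := Finset.mem_erase.mp hQ
  obtain rfl | hQs := Finset.mem_insert.mp hQ
  · have hrad := le_radical_of_frobeniusPower_le hIQ₀
    exact ⟨isPrimary_of_forall_smul_mem hQ₀ hrad hI htop,
      (frobeniusPower_mono ((Ideal.pow_le_self c.succ_ne_zero).trans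
        (radical_le_of_forall_smul_mem hQ₀ hrad hI htop)) _).trans hIQ₀⟩
  · obtain ⟨hJQ, hhQ⟩ := sup_le_iff.mp (hs.ge.trans (Finset.inf_le hQs))
    obtain ⟨g, hg, hgN⟩ := exists_radical_le_sup_span_singleton (hsprim hQs)
      (le_radical_of_frobeniusPower_le (hIJ.trans hJQ)) hI hh hhN
      ((Ideal.span_singleton_le_iff_mem _).mp hhQ)
    exact ⟨hsprim hQs, frobeniusPower_pow_le_of_le_sup_span_singleton hp hB (hIJ.trans hJQ) hg hgN⟩

end PrimaryDecomposition

theorem exists_fin_iInf_eq_inf {α : Type*} [CompleteLattice α] (T : Finset α) :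
    ∃ (m : ℕ) (Q : Fin m → α), (∀ i, Q i ∈ T) ∧ ⨅ i, Q i = T.inf id :=
  ⟨T.card, fun i => T.equivFin.symm i, fun i => (T.equivFin.symm i).2, by
    rw [T.equivFin.symm.iInf_comp (g := fun x : T => (x : α)), Finset.inf_eq_iInf, iInf_subtype]
    rfl⟩

section TXQuotient

open scoped Polynomial

variable {k : Type*} [Field k] {n r : ℕ}

theorem isHomogeneous_optionEquivRight {A : Type*} [CommSemiring A] {d : ℕ}
    {f : MvPolynomial (Option (Fin n)) A} (hf : IsWeightedHomogeneous (txWeight n) f d) :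
    (optionEquivRight A (Fin n) f).IsHomogeneous d := by
  rw [f.as_sum, map_sum]
  refine IsHomogeneous.sum _ _ _ fun m hm => ?_
  rw [optionEquivRight_apply, aeval_monomial, ← zero_add d, ← hf (mem_support_iff.mp hm),
    Finsupp.weight_apply]
  refine IsHomogeneous.mul (isHomogeneous_C _ _) (IsHomogeneous.prod _ _ _ fun o _ => ?_)
  rcases o with _ | i
  · simpa [txWeight] using (isHomogeneous_C (Fin n) (Polynomial.X : A[X])).pow (m none)
  · simpa [txWeight] using (isHomogeneous_X A[X] i).pow (m (some i))

theorem exists_forall_natDegree_coeff_le {A σ ι : Type*} [CommSemiring A] [Finite ι]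
    (F : ι → MvPolynomial σ A[X]) :
    ∃ D, ∀ j a, (coeff a (F j)).natDegree ≤ D := by
  have hF (j : ι) : ∃ D, ∀ a, (coeff a (F j)).natDegree ≤ D := by
    refine ⟨(F j).support.sup fun a => (coeff a (F j)).natDegree, fun a => ?_⟩
    by_cases ha : a ∈ (F j).support
    · exact Finset.le_sup (f := fun a => (coeff a (F j)).natDegree) ha
    · rw [notMem_support_iff.mp ha, Polynomial.natDegree_zero]
      exact Nat.zero_le _
  choose D hD using hF
  obtain ⟨N, hN⟩ := Finite.exists_le D
  exact ⟨N, fun j a => (hD j a).trans (hN j)⟩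

variable (f : Fin r → MvPolynomial (Option (Fin n)) k)

/-- The presentation of `k[t, x_1, …, x_n] / (f_1, …, f_r)` as a quotient of `k[t][x_1, …, x_n]`,
obtained by viewing `t` as a scalar. -/
noncomputable def txPresentation : MvPolynomial (Fin n) k[X] →+* TXQuotient f :=
  (Ideal.Quotient.mk _).comp (optionEquivRight k (Fin n)).symm.toRingEquiv.toRingHom

/-- The `k[t]`-algebra structure of `k[t, x_1, …, x_n] / (f_1, …, f_r)`. -/
noncomputable abbrev txAlgebra : Algebra k[X] (TXQuotient f) :=
  ((txPresentation f).comp C).toAlgebra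

attribute [local instance] txAlgebra

theorem txPresentation_surjective : Function.Surjective (txPresentation f) :=
  Ideal.Quotient.mk_surjective.comp (optionEquivRight k (Fin n)).symm.surjective

theorem ker_txPresentation :
    RingHom.ker (txPresentation f) =
      Ideal.span (Set.range fun j => optionEquivRight k (Fin n) (f j)) := by
  rw [txPresentation, ← RingHom.comap_ker, Ideal.mk_ker]
  refine (Ideal.comap_symm (optionEquivRight k (Fin n)).toRingEquiv).trans ?_
  rw [Ideal.map_span, ← Set.range_comp]
  rfl

theorem txPresentation_X (i : Fin n) :
    txPresentation f (X i) = Ideal.Quotient.mk _ (X (some i)) := by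
  rw [← optionEquivRight_X_some]
  exact congrArg _ (AlgEquiv.symm_apply_apply _ _)

theorem exists_algebraMap_sub_mem_xIdeal (b : TXQuotient f) :
    ∃ a : k[X], algebraMap k[X] (TXQuotient f) a - b ∈ xIdeal f := by
  obtain ⟨z, rfl⟩ := txPresentation_surjective f b
  induction z using MvPolynomial.induction_on with
  | C a =>
    refine ⟨a, ?_⟩
    rw [RingHom.algebraMap_toAlgebra, RingHom.comp_apply, sub_self]
    exact zero_mem _
  | add z w hz hw =>
    obtain ⟨a, ha⟩ := hz
    obtain ⟨b, hb⟩ := hw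
    refine ⟨a + b, ?_⟩
    rw [map_add, map_add, add_sub_add_comm]
    exact add_mem ha hb
  | mul_X z i _ =>
    refine ⟨0, ?_⟩
    rw [map_zero, zero_sub, neg_mem_iff, map_mul, txPresentation_X]
    exact Ideal.mul_mem_left _ _ (Ideal.subset_span ⟨i, rfl⟩)

theorem natCast_txQuotient_eq_zero (p : ℕ) [CharP k p] : (p : TXQuotient f) = 0 := by
  rw [← map_natCast (algebraMap k (TXQuotient f)), CharP.cast_eq_zero, map_zero]

theorem comap_txPresentation_frobeniusPower_xIdeal (p : ℕ) [Fact p.Prime] [CharP k p] (e : ℕ) :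
    ((xIdeal f).frobeniusPower (p ^ e)).comap (txPresentation f) =
      Ideal.span ((Set.range fun i => X i ^ p ^ e) ∪
        Set.range fun j => optionEquivRight k (Fin n) (f j)) := by
  have hmap : (xIdeal f).frobeniusPower (p ^ e) =
      (Ideal.span (Set.range fun i => X i ^ p ^ e)).map (txPresentation f) := by
    rw [xIdeal, Ideal.frobeniusPower_span Fact.out (natCast_txQuotient_eq_zero f p),
      Ideal.map_span, ← Set.range_comp, ← Set.range_comp]
    congr 2 with i
    rw [Function.comp_apply, Function.comp_apply, map_pow, txPresentation_X]
  rw [hmap, Ideal.comap_map_of_surjective _ (txPresentation_surjective f),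
    ← RingHom.ker_eq_comap_bot, ker_txPresentation, Ideal.span_union]

variable {f}

theorem exists_boundedTorsion_frobeniusPower_xIdeal (p : ℕ) [Fact p.Prime] [CharP k p] [NeZero n]
    (hf : ∀ j, ∃ d, IsWeightedHomogeneous (txWeight n) (f j) d) :
    ∃ D, ∀ e, BoundedTorsion (((xIdeal f).frobeniusPower (p ^ e)).restrictScalars k[X])
      (D * (p ^ e) ^ (n - 1)) := by
  obtain ⟨D, hD⟩ := exists_forall_natDegree_coeff_le fun j => optionEquivRight k (Fin n) (f j)
  let π : MvPolynomial (Fin n) k[X] →ₐ[k[X]] TXQuotient f :=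
    { txPresentation f with commutes' := fun _ => rfl }
  refine ⟨D, fun e => .of_comap (φ := π.toLinearMap) (txPresentation_surjective f) ?_⟩
  let S := (Set.range fun i => X i ^ p ^ e) ∪ Set.range fun j => optionEquivRight k (Fin n) (f j)
  have hcomap : (((xIdeal f).frobeniusPower (p ^ e)).restrictScalars k[X]).comap π.toLinearMap =
      (Ideal.span S).restrictScalars k[X] :=
    congrArg (Submodule.restrictScalars k[X]) (comap_txPresentation_frobeniusPower_xIdeal f p e)
  have hhom : ∀ z ∈ S, ∃ d, z.IsHomogeneous d := by
    rintro _ (⟨i, rfl⟩ | ⟨j, rfl⟩)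
    · exact ⟨p ^ e, isHomogeneous_X_pow i _⟩
    · exact (hf j).imp fun _ => isHomogeneous_optionEquivRight
  have hdeg : ∀ z ∈ S, ∀ a, (coeff a z).natDegree ≤ D := by
    rintro _ (⟨i, rfl⟩ | ⟨j, rfl⟩) a
    · rw [coeff_X_pow]
      split_ifs <;> simp
    · exact hD j a
  have hS := boundedTorsion_restrictScalars_span hhom hdeg fun i =>
    Ideal.subset_span (.inl ⟨i, rfl⟩)
  rwa [Fintype.card_fin, ← hcomap] at hS

end TXQuotient

theorem mainTheorem2 {k : Type*} [Field k] (p : ℕ) [Fact p.Prime] [CharP k p]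
    (n : ℕ) (hn : 2 ≤ n) (r : ℕ) (f : Fin r → MvPolynomial (Option (Fin n)) k)
    (hf : ∀ j : Fin r, ∃ d : ℕ, IsWeightedHomogeneous (txWeight n) (f j) d) :
    ∃ c : ℕ, ∀ e q : ℕ, q = p ^ e →
      ∃ (m : ℕ) (Q : Fin m → Ideal (TXQuotient f)),
        (xIdeal f).frobeniusPower q = ⨅ i : Fin m, Q i ∧
        (∀ i : Fin m, (Q i).IsPrimary) ∧
        ∀ i : Fin m, ((Q i).radical ^ c).frobeniusPower (q ^ (n - 1)) ≤ Q i := by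
  have hp : p.Prime := Fact.out
  have : NeZero n := ⟨by lia⟩
  let _ := txAlgebra f
  obtain ⟨D, hD⟩ := exists_boundedTorsion_frobeniusPower_xIdeal p hf
  refine ⟨D + 1, ?_⟩
  rintro e _ rfl
  have hq : p ^ e ≤ p ^ (e * (n - 1)) :=
    Nat.pow_le_pow_right hp.pos (Nat.le_mul_of_pos_right e (by lia))
  rw [← pow_mul]
  obtain ⟨T, hT, hprim⟩ := BoundedTorsion.exists_primary_decomposition (A := Polynomial k) hp
    (natCast_txQuotient_eq_zero f p) (exists_algebraMap_sub_mem_xIdeal f)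
    (frobeniusPower_anti hq (xIdeal f)) (by simpa only [← pow_mul] using hD e)
  obtain ⟨m, Q, hQ, hinf⟩ := exists_fin_iInf_eq_inf T
  exact ⟨m, Q, (hinf.trans hT).symm, fun i => (hprim _ (hQ i)).1, fun i => (hprim _ (hQ i)).2⟩
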